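/- Let $M$ be a unital (complex) $C^*$-algebra with norm $\|\cdot\|$. Let $\mathcal I_0\subseteq M$ be a two-sided ideal (not necessarily closed) with a norm $\|\cdot\|_{\mathcal I}$ of its own satisfying $\|ATB\|_{\mathcal I}\le\|A\|\,\|T\|_{\mathcal I}\,\|B\|$ for all $A,B\in M$ and $T\in\mathcal I_0$, and let $\mathcal I$ be the completion of $\mathcal I_0$ with respect to $\|\cdot\|_{\mathcal I}$. For $A\in M$ let $L_A,R_A\in\mathcal B(\mathcal I)$ be the continuous extensions to $\mathcal I$ of the multiplications $T\mapsto AT$ and $T\mapsto TA$, and write $ATB=L_AR_BT$ for $T\in\mathcal I$ and $A,B\in M$. For $D\in\mathcal B(\mathcal I)$ put $\cosh D=\frac12(e^{D}+e^{-D})$, $\sinh D=\frac12(e^{D}-e^{-D})$ and, if $\cosh D$ is invertible in $\mathcal B(\mathcal I)$, $\tanh D=\sinh D\,(\cosh D)^{-1}$. Let $S,R\in M$ be invertible, and let $X,Y\in M$ be self-adjoint with $|S|=e^X$ and $|R|=e^Y$, where $|A|=(A^*A)^{1/2}$. Then $\cosh(L_X-R_Y)$ is invertible in $\mathcal B(\mathcal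 I)$, and for every $T\in\mathcal I$ $$\|STR^{-1}-(S^*)^{-1}TR^*\|_{\mathcal I}\le\|\tanh(L_X-R_Y)\|_{\mathcal B(\mathcal I)}\;\|STR^{-1}+(S^*)^{-1}TR^*\|_{\mathcal I}$$ and $$\|STR^{-1}-(S^*)^{-1}TR^*\|_{\mathcal I}\le\|L_X-R_Y\|_{\mathcal B(\mathcal I)}\;\|STR^{-1}+(S^*)^{-1}TR^*\|_{\mathcal I}.$$ -/

import Mathlib

noncomputable section

/-- A normed ideal with a unitarily invariant norm in a unital C⋆-algebra `M`: a two-sided ideal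
of `M` (not assumed to be closed) with a norm of its own, such that
`‖x t z‖_I ≤ ‖x‖ ‖t‖_I ‖z‖` for `x, z ∈ M` and `t` in the ideal. -/
structure NormedIdeal (M : Type*) [CStarAlgebra M] where
  /-- the underlying linear subspace of `M` -/
  carrier : Submodule ℂ M
  mul_mem' : ∀ (x z : M) {t : M}, t ∈ carrier → x * t * z ∈ carrier
  /-- the norm of the ideal -/
  idealNorm : Seminorm ℂ carrier
  eq_zero_of_idealNorm : ∀ t : carrier, idealNorm t = 0 → t = 0
  idealNorm_mul_le : ∀ (x z : M) (t : carrier),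
    idealNorm ⟨x * t * z, mul_mem' x z t.2⟩ ≤ ‖x‖ * idealNorm t * ‖z‖

namespace NormedIdeal

variable {M : Type*} [CStarAlgebra M] (I : NormedIdeal M)

/-- The elements of the ideal, as a type that carries the norm of the ideal
(and not the norm of `M`). -/
def Elem : Type _ := I.carrier

instance : AddCommGroup I.Elem := inferInstanceAs (AddCommGroup I.carrier)

instance : Module ℂ I.Elem := inferInstanceAs (Module ℂ I.carrier)

instance : Norm I.Elem := ⟨fun t => I.idealNorm t⟩

theorem normedSpaceCore : NormedSpace.Core ℂ I.Elem where
  norm_nonneg t := apply_nonneg I.idealNorm t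
  norm_smul c t := map_smul_eq_mul I.idealNorm c t
  norm_triangle s t := map_add_le_add I.idealNorm s t
  norm_eq_zero_iff t := ⟨fun h => I.eq_zero_of_idealNorm t h, fun h => by
    rw [h]; exact map_zero I.idealNorm⟩

instance : NormedAddCommGroup I.Elem := NormedAddCommGroup.ofCore I.normedSpaceCore

instance : NormedSpace ℂ I.Elem := NormedSpace.ofCore I.normedSpaceCore

/-- The two-sided multiplication `t ↦ x * t * z` on the ideal. -/
def mulMul (x z : M) : I.Elem →ₗ[ℂ] I.Elem where
  toFun t := ⟨x * t.1 * z, I.mul_mem' x z t.2⟩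
  map_add' s t := Subtype.ext (by
    change x * (s.1 + t.1) * z = x * s.1 * z + x * t.1 * z
    rw [mul_add, add_mul])
  map_smul' c t := Subtype.ext (by
    change x * (c • t.1) * z = c • (x * t.1 * z)
    rw [mul_smul_comm, smul_mul_assoc])

theorem norm_mulMul_le (x z : M) (t : I.Elem) : ‖I.mulMul x z t‖ ≤ (‖x‖ * ‖z‖) * ‖t‖ := by
  calc ‖I.mulMul x z t‖ ≤ ‖x‖ * ‖t‖ * ‖z‖ := I.idealNorm_mul_le x z t
    _ = (‖x‖ * ‖z‖) * ‖t‖ := by ring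

/-- The Banach space obtained by completing the ideal in its norm. -/
abbrev Compl : Type _ := UniformSpace.Completion I.Elem

/-- Left multiplication `L_x : t ↦ x t`, extended by continuity to the completion of the ideal. -/
def L (x : M) : I.Compl →L[ℂ] I.Compl :=
  ((I.mulMul x 1).mkContinuous (‖x‖ * ‖(1 : M)‖) (I.norm_mulMul_le x 1)).completion

/-- Right multiplication `R_x : t ↦ t x`, extended by continuity to the completion of the ideal. -/
def R (x : M) : I.Compl →L[ℂ] I.Compl :=
  ((I.mulMul 1 x).mkContinuous (‖(1 : M)‖ * ‖x‖) (I.norm_mulMul_le 1 x)).completion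

end NormedIdeal

/-- `cosh a = (e^a + e^(-a)) / 2` in a complex Banach algebra. -/
def banachCosh {A : Type*} [NormedRing A] [NormedAlgebra ℂ A] (a : A) : A :=
  (1 / 2 : ℂ) • (NormedSpace.exp a + NormedSpace.exp (-a))

/-- `sinh a = (e^a - e^(-a)) / 2` in a complex Banach algebra. -/
def banachSinh {A : Type*} [NormedRing A] [NormedAlgebra ℂ A] (a : A) : A :=
  (1 / 2 : ℂ) • (NormedSpace.exp a - NormedSpace.exp (-a))

/-- `tanh a = sinh a (cosh a)⁻¹` in a complex Banach algebra. It is meaningful when `cosh a` is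
invertible, that is, when no zero of `cosh` lies in the spectrum of `a`. -/
def banachTanh {A : Type*} [NormedRing A] [NormedAlgebra ℂ A] (a : A) : A :=
  banachSinh a * Ring.inverse (banachCosh a)

end

open Filter Topology

/-! Write `S = U e^X` and `R = V e^Y` with `U`, `V` unitary, and put `D = L_X - R_Y`. Since `L_X`
and `R_Y` commute, the two terms of the inequality are `e^D T` and `e^(-D) T` up to the common
isometry `L_U R_(V*)`. It remains to bound `‖sinh D T‖` by `‖tanh D‖` or `‖D‖` times `‖cosh D T‖`.

The operators `e^(itD)` are isometric, so `cosh(ihD)` is a contraction. As `cosh(hD) = 2 - cosh(ihD)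
+ o(h²)`, the identity `cosh((s+h)D) + cosh((s-h)D) = 2 cosh(hD) cosh(sD)` bounds the second
symmetric differences of `s ↦ ‖cosh(sD) v‖` below by `o(h²)`. This even function therefore increases
with `|s|` (`IsHermitianOperator.norm_banachCosh_smul_le_of_abs_le`). Comparison with `s = 0` makes
`cosh(sD)` bounded below, hence invertible by continuation from `s = 0`; comparison with `s = 1`
controls the derivative `D cosh(sD) v` of `sinh(sD) v`. -/

/-- A continuous even function whose second symmetric differences are bounded below by `o(h²)`
is monotone in `|s|`. -/
theorem le_of_even_of_eventually_symm_diff {g : ℝ → ℝ} (hc : Continuous g)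
    (heven : ∀ s, g (-s) = g s)
    (hg : ∀ s, ∀ ε > 0, ∀ᶠ h in 𝓝 (0 : ℝ), 2 * g s ≤ g (s + h) + g (s - h) + ε * h ^ 2)
    {s t : ℝ} (hst : |s| ≤ t) : g s ≤ g t := by
  have ht : 0 ≤ t := (abs_nonneg s).trans hst
  -- The term `ε x²` adds `2εh²` to the second difference, more than the allowed loss `εh²`, so no
  -- maximum is interior.
  have key : ∀ ε > 0, g s + ε * s ^ 2 ≤ g t + ε * t ^ 2 := by
    intro ε hε
    obtain ⟨x, hx, hmax⟩ := (isCompact_Icc (a := -t) (b := t)).exists_isMaxOn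
      ⟨s, abs_le.1 hst⟩ (f := fun x => g x + ε * x ^ 2) (by fun_prop)
    have hs := hmax (abs_le.1 hst)
    simp only [Set.mem_ofPred_eq] at hs
    refine hs.trans ?_
    rcases hx.1.eq_or_lt with h1 | h1
    · rw [← h1, heven]; simp
    rcases hx.2.eq_or_lt with h2 | h2
    · rw [h2]
    exfalso
    have e1 : ∀ᶠ h in 𝓝 (0 : ℝ), x + h ∈ Set.Icc (-t) t :=
      ((continuous_const.add continuous_id).tendsto' (0 : ℝ) x (by simp)).eventually
        (Icc_mem_nhds h1 h2)
    have e2 : ∀ᶠ h in 𝓝 (0 : ℝ), x - h ∈ Set.Icc (-t) t :=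
      ((continuous_const.sub continuous_id).tendsto' (0 : ℝ) x (by simp)).eventually
        (Icc_mem_nhds h1 h2)
    obtain ⟨h, ⟨⟨h3, h4⟩, h5⟩, h0⟩ :=
      ((((e1.and e2).and (hg x ε hε)).filter_mono nhdsWithin_le_nhds).and
        (self_mem_nhdsWithin (s := Set.Ioi (0 : ℝ)))).exists
    have m1 := hmax h3
    have m2 := hmax h4
    simp only [Set.mem_ofPred_eq] at m1 m2
    have : 0 < ε * h ^ 2 := mul_pos hε (pow_pos h0 2)
    nlinarith
  have h1 : Tendsto (fun ε : ℝ => g s + ε * s ^ 2) (𝓝[>] 0) (𝓝 (g s)) :=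
    (Continuous.tendsto' (by fun_prop) 0 _ (by simp)).mono_left nhdsWithin_le_nhds
  have h2 : Tendsto (fun ε : ℝ => g t + ε * t ^ 2) (𝓝[>] 0) (𝓝 (g t)) :=
    (Continuous.tendsto' (by fun_prop) 0 _ (by simp)).mono_left nhdsWithin_le_nhds
  exact le_of_tendsto_of_tendsto h1 h2
    (eventually_nhdsWithin_of_forall fun ε hε => key ε hε)

/-! ### Hyperbolic functions in a Banach algebra -/

section BanachAlgebra

variable {A : Type*} [NormedRing A] [NormedAlgebra ℂ A]

@[simp] theorem banachCosh_zero : banachCosh (0 : A) = 1 := by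
  rw [banachCosh, neg_zero, NormedSpace.exp_zero, ← two_smul ℂ, smul_smul]; norm_num

@[simp] theorem banachSinh_zero : banachSinh (0 : A) = 0 := by
  rw [banachSinh, neg_zero, sub_self, smul_zero]

@[simp] theorem banachCosh_neg (a : A) : banachCosh (-a) = banachCosh a := by
  rw [banachCosh, banachCosh, neg_neg, add_comm]

variable [CompleteSpace A]

theorem exp_add_of_commute_complex {a b : A} (h : Commute a b) :
    NormedSpace.exp (a + b) = NormedSpace.exp a * NormedSpace.exp b := by
  let +nondep : NormedAlgebra ℚ A := .restrictScalars ℚ ℂ A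
  exact NormedSpace.exp_add_of_commute h

theorem continuous_exp_complex : Continuous (NormedSpace.exp : A → A) := by
  let +nondep : NormedAlgebra ℚ A := .restrictScalars ℚ ℂ A
  exact NormedSpace.exp_continuous

theorem exp_mul_exp_neg (a : A) : NormedSpace.exp a * NormedSpace.exp (-a) = 1 := by
  rw [← exp_add_of_commute_complex (Commute.refl a).neg_right, add_neg_cancel,
    NormedSpace.exp_zero]

theorem exp_neg_mul_exp (a : A) : NormedSpace.exp (-a) * NormedSpace.exp a = 1 := by
  simpa using exp_mul_exp_neg (-a)

theorem continuous_banachCosh : Continuous (banachCosh : A → A) :=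
  ((continuous_exp_complex).add (continuous_exp_complex.comp continuous_neg)).const_smul _

theorem banachCosh_add_add_banachCosh_sub {a b : A} (h : Commute a b) :
    banachCosh (a + b) + banachCosh (a - b) = (2 : ℂ) • (banachCosh b * banachCosh a) := by
  have e1 : -(a + b) = -b + -a := by abel
  have e2 : a - b = -b + a := by abel
  have e3 : -(a - b) = b + -a := by abel
  simp only [banachCosh]
  rw [e1, e3, e2, add_comm a b, exp_add_of_commute_complex h.symm,
    exp_add_of_commute_complex h.symm.neg_left.neg_right,
    exp_add_of_commute_complex h.symm.neg_left, exp_add_of_commute_complex h.symm.neg_right]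
  simp only [smul_mul_smul_comm, add_mul, mul_add, smul_add, smul_smul]
  norm_num
  abel

theorem exp_sub_isLittleO_sq :
    (fun y : A => NormedSpace.exp y - (1 + y + (1 / 2 : ℂ) • y ^ 2)) =o[𝓝 0] fun y => ‖y‖ ^ 2 := by
  have h := (NormedSpace.exp_hasFPowerSeriesAt_zero (𝕂 := ℂ) (𝔸 := A)).isBigO_sub_partialSum_pow 3
  simp only [zero_add, FormalMultilinearSeries.partialSum, NormedSpace.expSeries_apply_eq,
    Finset.sum_range_succ, Finset.sum_range_zero] at h
  norm_num [Nat.factorial] at h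
  refine h.trans_isLittleO ?_
  have h2 : (fun r : ℝ => r ^ 3) =o[𝓝 0] fun r => r ^ 2 := Asymptotics.isLittleO_pow_pow (by norm_num)
  exact h2.comp_tendsto tendsto_norm_zero

/-- `cosh (h a) + cos (h a) = 2 + o(h²)`. -/
theorem banachCosh_add_banachCosh_I_isLittleO (a : A) :
    (fun h : ℝ => banachCosh ((h : ℂ) • a) + banachCosh ((h * Complex.I) • a) - 2)
      =o[𝓝 0] fun h => h ^ 2 := by
  have key : ∀ c : ℂ, (fun h : ℝ => NormedSpace.exp ((h * c) • a) -
      (1 + (h * c) • a + (1 / 2 : ℂ) • ((h * c) • a) ^ 2)) =o[𝓝 0] fun h => h ^ 2 := by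
    intro c
    have ht : Tendsto (fun h : ℝ => (h * c) • a) (𝓝 0) (𝓝 0) :=
      Continuous.tendsto' (by fun_prop) _ _ (by simp)
    refine (exp_sub_isLittleO_sq.comp_tendsto ht).trans_isBigO ?_
    refine Asymptotics.IsBigO.of_bound (‖c • a‖ ^ 2) (Eventually.of_forall fun h => ?_)
    simp only [Function.comp_apply, mul_smul, norm_smul, norm_pow, Complex.norm_real, norm_mul,
      norm_norm]
    exact le_of_eq (by ring)
  -- Odd terms cancel within each pair `±c`; the quadratic terms for `c = 1` and `c = I` cancel each
  -- other.
  refine ((((key 1).add (key (-1))).add ((key Complex.I).add (key (-Complex.I)))).const_smul_left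
    (1 / 2 : ℂ)).congr_left fun h => ?_
  have h2 : (2 : A) = (2 : ℂ) • (1 : A) := by rw [two_smul]; norm_num
  simp only [banachCosh, mul_one, mul_neg, neg_smul, smul_pow, neg_sq, mul_pow, Complex.I_sq, Pi.smul_apply]
  rw [h2]
  module

theorem hasDerivAt_banachSinh_smul (a : A) (s : ℝ) :
    HasDerivAt (fun s : ℝ => banachSinh ((s : ℂ) • a)) (a * banachCosh ((s : ℂ) • a)) s := by
  have h1 : HasDerivAt (fun z : ℂ => NormedSpace.exp (z • a)) _ (s : ℂ) :=
    hasDerivAt_exp_smul_const' a (s : ℂ)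
  have h2 : HasDerivAt (fun z : ℂ => NormedSpace.exp (z • -a)) _ (s : ℂ) :=
    hasDerivAt_exp_smul_const' (-a) (s : ℂ)
  have h3 := ((h1.sub h2).const_smul (1 / 2 : ℂ)).scomp_of_eq s Complex.ofRealCLM.hasDerivAt rfl
  simp only [Complex.ofRealCLM_apply, Complex.ofReal_one, one_smul] at h3
  refine (h3.congr_of_eventuallyEq (Eventually.of_forall fun s => ?_)).congr_deriv ?_
  · simp [banachSinh]
  · simp [banachCosh, mul_add]

end BanachAlgebra

/-! ### Hermitian operators: monotonicity and invertibility of cosh -/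

section Hermitian

variable {E : Type*} [NormedAddCommGroup E] [NormedSpace ℂ E]

/-- A bounded operator `D` on a complex Banach space is Hermitian if the operators `e^(itD)`
with `t` real are contractions. -/
def IsHermitianOperator (D : E →L[ℂ] E) : Prop :=
  ∀ (t : ℝ) (v : E), ‖NormedSpace.exp ((t * Complex.I) • D) v‖ ≤ ‖v‖

variable {D : E →L[ℂ] E}

theorem IsHermitianOperator.ofReal_smul (hD : IsHermitianOperator D) (s : ℝ) :
    IsHermitianOperator ((s : ℂ) • D) := by
  intro t v
  have := hD (t * s) v
  rwa [smul_smul, mul_right_comm, ← Complex.ofReal_mul]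

theorem IsHermitianOperator.norm_banachCosh_I_le (hD : IsHermitianOperator D) (t : ℝ) (v : E) :
    ‖banachCosh ((t * Complex.I) • D) v‖ ≤ ‖v‖ := by
  have h1 := hD t v
  have h2 := hD (-t) v
  rw [Complex.ofReal_neg, neg_mul, neg_smul] at h2
  rw [banachCosh, smul_apply, add_apply, norm_smul]
  have h3 := norm_add_le (NormedSpace.exp ((t * Complex.I) • D) v)
    (NormedSpace.exp (-((t * Complex.I) • D)) v)
  norm_num
  linarith

variable [CompleteSpace E]

theorem IsHermitianOperator.norm_banachCosh_smul_le_of_abs_le (hD : IsHermitianOperator D)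
    (v : E) {s t : ℝ} (hst : |s| ≤ t) :
    ‖banachCosh ((s : ℂ) • D) v‖ ≤ ‖banachCosh ((t : ℂ) • D) v‖ := by
  refine le_of_even_of_eventually_symm_diff (g := fun s : ℝ => ‖banachCosh ((s : ℂ) • D) v‖)
    ?_ ?_ ?_ hst
  · have h : Continuous fun s : ℝ => banachCosh ((s : ℂ) • D) :=
      continuous_banachCosh.comp (by fun_prop)
    exact (h.clm_apply continuous_const).norm
  · intro s
    simp
  · intro s ε hε
    set w := banachCosh ((s : ℂ) • D) v with hw
    -- Applied to `w`, this constant leaves an error of at most `εh²/2`, which doubling in `n1`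
    -- turns into `εh²`; the `+ 1` covers `w = 0`.
    have hε' : 0 < ε / (2 * (‖w‖ + 1)) := by positivity
    filter_upwards [(banachCosh_add_banachCosh_I_isLittleO D).def hε'] with h hh
    have hcomm : Commute ((s : ℂ) • D) ((h : ℂ) • D) :=
      ((Commute.refl D).smul_left _).smul_right _
    have e := congrArg (fun T : E →L[ℂ] E => T v) (banachCosh_add_add_banachCosh_sub hcomm)
    simp only [← add_smul, ← sub_smul, add_apply,
      smul_apply, mul_apply_eq_comp, ← Complex.ofReal_add,
      ← Complex.ofReal_sub, ← hw] at e
    have n1 : 2 * ‖banachCosh ((h : ℂ) • D) w‖ ≤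
        ‖banachCosh (((s + h : ℝ) : ℂ) • D) v‖ + ‖banachCosh (((s - h : ℝ) : ℂ) • D) v‖ := by
      refine le_trans (le_of_eq ?_) (norm_add_le _ _)
      rw [e, norm_smul]; norm_num
    set P := banachCosh ((h : ℂ) • D)
    set Q := banachCosh ((h * Complex.I) • D)
    have n2 : ‖Q w‖ ≤ ‖w‖ := hD.norm_banachCosh_I_le h w
    have n3 : ‖(P + Q - 2) w‖ ≤ ε / 2 * h ^ 2 := by
      refine (ContinuousLinearMap.le_opNorm _ _).trans ?_
      refine (mul_le_mul_of_nonneg_right hh (norm_nonneg _)).trans ?_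
      rw [norm_pow, Real.norm_eq_abs, sq_abs]
      have : ‖w‖ / (‖w‖ + 1) ≤ 1 := by rw [div_le_one (by positivity)]; linarith
      calc ε / (2 * (‖w‖ + 1)) * h ^ 2 * ‖w‖ = ε / 2 * h ^ 2 * (‖w‖ / (‖w‖ + 1)) := by
            field_simp
        _ ≤ ε / 2 * h ^ 2 * 1 := by gcongr
        _ = _ := mul_one _
    have n4 : 2 * ‖w‖ ≤ ‖P w‖ + ‖Q w‖ + ‖(P + Q - 2) w‖ := by
      have e2 : (2 : ℂ) • w = P w + Q w - (P + Q - 2) w := by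
        have : (2 : E →L[ℂ] E) w = (2 : ℂ) • w := by
          rw [← one_add_one_eq_two, add_apply, two_smul]; rfl
        rw [sub_apply, add_apply, this]; abel
      calc 2 * ‖w‖ = ‖(2 : ℂ) • w‖ := by rw [norm_smul]; norm_num
        _ ≤ ‖P w + Q w‖ + ‖(P + Q - 2) w‖ := by rw [e2]; exact norm_sub_le _ _
        _ ≤ _ := by gcongr; exact norm_add_le _ _
    linarith

theorem IsHermitianOperator.norm_le_norm_banachCosh (hD : IsHermitianOperator D) (v : E) :
    ‖v‖ ≤ ‖banachCosh D v‖ := by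
  simpa using hD.norm_banachCosh_smul_le_of_abs_le v (s := 0) (t := 1) (by simp)

/-- Mean value inequality on `[0, 1]`: the derivative `D cosh(sD) v` is largest in the bound at `s =
1`, by monotonicity. -/
theorem IsHermitianOperator.norm_banachSinh_le (hD : IsHermitianOperator D) (v : E) :
    ‖banachSinh D v‖ ≤ ‖D‖ * ‖banachCosh D v‖ := by
  have h := norm_image_sub_le_of_norm_deriv_le_segment_01'
    (f := fun s : ℝ => banachSinh ((s : ℂ) • D) v)
    (f' := fun s : ℝ => (D * banachCosh ((s : ℂ) • D)) v) (C := ‖D‖ * ‖banachCosh D v‖)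
    (fun s _ => ((((ContinuousLinearMap.apply ℂ E v).restrictScalars ℝ).hasFDerivAt.comp_hasDerivAt
      s (hasDerivAt_banachSinh_smul D s))).hasDerivWithinAt)
    (fun s hs => ?_)
  · simpa using h
  · rw [mul_apply_eq_comp]
    refine (D.le_opNorm _).trans (mul_le_mul_of_nonneg_left ?_ (norm_nonneg _))
    simpa using hD.norm_banachCosh_smul_le_of_abs_le v (s := s) (t := 1)
      (by rw [abs_of_nonneg hs.1]; exact hs.2.le)

/-- Along a path of operators that are uniformly bounded below, invertibility persists. -/
theorem isUnit_of_path_norm_le {f : ℝ → E →L[ℂ] E} (hf : Continuous f) (h0 : IsUnit (f 0))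
    (hb : ∀ s v, ‖v‖ ≤ ‖f s v‖) (s : ℝ) : IsUnit (f s) := by
  have hopen : IsOpen {s | IsUnit (f s)} := Units.isOpen.preimage hf
  have hclosed : IsClosed {s | IsUnit (f s)} := by
    refine isClosed_of_closure_subset fun s hs => ?_
    obtain ⟨r, hr, hrs⟩ := (mem_closure_iff_frequently.1 hs).and_eventually
      ((hf.tendsto s).eventually (Metric.ball_mem_nhds (f s) one_half_pos)) |>.exists
    obtain ⟨u, hu⟩ := hr
    -- The lower bound gives `‖(f r)⁻¹‖ ≤ 1` for every such `r`, so the radius of invertibility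
    -- around `f r` does not shrink as `r` approaches `s`.
    have hinv : ‖((u⁻¹ : (E →L[ℂ] E)ˣ) : E →L[ℂ] E)‖ ≤ 1 := by
      refine ContinuousLinearMap.opNorm_le_bound _ zero_le_one fun v => ?_
      refine (hb r _).trans (le_of_eq ?_)
      rw [← hu, ← mul_apply_eq_comp, Units.mul_inv, one_mul]; rfl
    have hlt : ‖((u⁻¹ : (E →L[ℂ] E)ˣ) : E →L[ℂ] E) * (f r - f s)‖ < 1 := by
      have h1 : ‖f r - f s‖ < 1 / 2 := by simpa [dist_eq_norm] using hrs
      calc _ ≤ ‖((u⁻¹ : (E →L[ℂ] E)ˣ) : E →L[ℂ] E)‖ * ‖f r - f s‖ := norm_mul_le _ _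
        _ ≤ 1 * ‖f r - f s‖ := by gcongr
        _ < 1 := by linarith
    have h2 : f s = u * (1 - (u⁻¹ : (E →L[ℂ] E)ˣ) * (f r - f s)) := by
      rw [mul_sub, ← mul_assoc, Units.mul_inv, one_mul, mul_one, hu]; abel
    change IsUnit (f s)
    rw [h2]
    exact u.isUnit.mul (isUnit_one_sub_of_norm_lt_one hlt)
  have := IsClopen.eq_univ ⟨hclosed, hopen⟩ ⟨0, h0⟩
  exact Set.eq_univ_iff_forall.1 this s

theorem IsHermitianOperator.isUnit_banachCosh (hD : IsHermitianOperator D) :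
    IsUnit (banachCosh D) := by
  have h := isUnit_of_path_norm_le (f := fun s : ℝ => banachCosh ((s : ℂ) • D))
    (continuous_banachCosh.comp (by fun_prop)) (by simp)
    (fun s v => (hD.ofReal_smul s).norm_le_norm_banachCosh v) 1
  simpa using h

end Hermitian

/-! ### Multiplication operators on the completed ideal -/

namespace NormedIdeal

variable {M : Type*} [CStarAlgebra M] (I : NormedIdeal M)

theorem L_coe (x : M) (t : I.Elem) :
    I.L x (t : I.Compl) = ((I.mulMul x 1 t : I.Elem) : I.Compl) :=
  ContinuousLinearMap.completion_apply_coe _ t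

theorem R_coe (x : M) (t : I.Elem) :
    I.R x (t : I.Compl) = ((I.mulMul 1 x t : I.Elem) : I.Compl) :=
  ContinuousLinearMap.completion_apply_coe _ t

variable {I} in
theorem clm_ext {f g : I.Compl →L[ℂ] I.Compl} (h : ∀ t : I.Elem, f t = g t) : f = g :=
  ContinuousLinearMap.ext fun v =>
    congrFun (UniformSpace.Completion.ext f.continuous g.continuous h) v

theorem L_mul (x y : M) : I.L (x * y) = I.L x * I.L y := by
  refine clm_ext fun t => ?_
  rw [mul_apply_eq_comp, L_coe, L_coe, L_coe]
  congr 1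
  refine Subtype.ext ?_
  change x * y * t.1 * 1 = x * (y * t.1 * 1) * 1
  simp only [mul_one, mul_assoc]

theorem R_mul (x y : M) : I.R (x * y) = I.R y * I.R x := by
  refine clm_ext fun t => ?_
  rw [mul_apply_eq_comp, R_coe, R_coe, R_coe]
  congr 1
  refine Subtype.ext ?_
  change 1 * t.1 * (x * y) = 1 * (1 * t.1 * x) * y
  simp only [one_mul, mul_assoc]

theorem L_R_commute (x y : M) : Commute (I.L x) (I.R y) := by
  refine clm_ext fun t => ?_
  rw [mul_apply_eq_comp, mul_apply_eq_comp, R_coe, L_coe, L_coe, R_coe]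
  congr 1
  refine Subtype.ext ?_
  change x * (1 * t.1 * y) * 1 = 1 * (x * t.1 * 1) * y
  simp only [one_mul, mul_one, mul_assoc]

theorem L_one : I.L 1 = 1 := by
  refine clm_ext fun t => ?_
  rw [L_coe]
  congr 1
  refine Subtype.ext ?_
  change 1 * t.1 * 1 = t.1
  simp only [one_mul, mul_one]

/-- `L_1` and `R_1` both extend `t ↦ 1 * t * 1`, so they agree by definition. -/
theorem R_one : I.R 1 = 1 := I.L_one

theorem L_add (x y : M) : I.L (x + y) = I.L x + I.L y := by
  refine clm_ext fun t => ?_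
  rw [add_apply, L_coe, L_coe, L_coe, ← UniformSpace.Completion.coe_add]
  congr 1
  refine Subtype.ext ?_
  change (x + y) * t.1 * 1 = x * t.1 * 1 + y * t.1 * 1
  simp only [mul_one, add_mul]

theorem R_add (x y : M) : I.R (x + y) = I.R x + I.R y := by
  refine clm_ext fun t => ?_
  rw [add_apply, R_coe, R_coe, R_coe, ← UniformSpace.Completion.coe_add]
  congr 1
  refine Subtype.ext ?_
  change 1 * t.1 * (x + y) = 1 * t.1 * x + 1 * t.1 * y
  simp only [mul_add]

theorem L_smul (c : ℂ) (x : M) : I.L (c • x) = c • I.L x := by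
  refine clm_ext fun t => ?_
  rw [smul_apply, L_coe, L_coe, ← UniformSpace.Completion.coe_smul]
  congr 1
  refine Subtype.ext ?_
  change c • x * t.1 * 1 = c • (x * t.1 * 1)
  simp only [smul_mul_assoc]

theorem R_smul (c : ℂ) (x : M) : I.R (c • x) = c • I.R x := by
  refine clm_ext fun t => ?_
  rw [smul_apply, R_coe, R_coe, ← UniformSpace.Completion.coe_smul]
  congr 1
  refine Subtype.ext ?_
  change 1 * t.1 * (c • x) = c • (1 * t.1 * x)
  simp only [mul_smul_comm]

theorem norm_L_apply_le (x : M) (v : I.Compl) : ‖I.L x v‖ ≤ ‖x‖ * ‖(1 : M)‖ * ‖v‖ := by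
  refine UniformSpace.Completion.induction_on v
    (isClosed_le (by fun_prop) (by fun_prop)) fun t => ?_
  rw [L_coe, UniformSpace.Completion.norm_coe, UniformSpace.Completion.norm_coe]
  exact I.norm_mulMul_le x 1 t

theorem norm_R_apply_le (x : M) (v : I.Compl) : ‖I.R x v‖ ≤ ‖x‖ * ‖(1 : M)‖ * ‖v‖ := by
  refine UniformSpace.Completion.induction_on v
    (isClosed_le (by fun_prop) (by fun_prop)) fun t => ?_
  rw [R_coe, UniformSpace.Completion.norm_coe, UniformSpace.Completion.norm_coe, mul_comm ‖x‖]
  exact I.norm_mulMul_le 1 x t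

/-- Only an inequality, because `M` may be the zero algebra. -/
theorem norm_one_le_one : ‖(1 : M)‖ ≤ 1 := by
  nontriviality M
  exact CStarRing.norm_one.le

theorem norm_le_one_of_mem_unitary {u : M} (hu : u ∈ unitary M) : ‖u‖ ≤ 1 := by
  simpa using (CStarRing.norm_mem_unitary_mul (1 : M) hu).le.trans norm_one_le_one

theorem norm_L_apply_le_of_mem_unitary {u : M} (hu : u ∈ unitary M) (v : I.Compl) :
    ‖I.L u v‖ ≤ ‖v‖ := by
  refine (I.norm_L_apply_le u v).trans (mul_le_of_le_one_left (norm_nonneg v) ?_)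
  exact mul_le_one₀ (norm_le_one_of_mem_unitary hu) (norm_nonneg _) norm_one_le_one

theorem norm_R_apply_le_of_mem_unitary {u : M} (hu : u ∈ unitary M) (v : I.Compl) :
    ‖I.R u v‖ ≤ ‖v‖ := by
  refine (I.norm_R_apply_le u v).trans (mul_le_of_le_one_left (norm_nonneg v) ?_)
  exact mul_le_one₀ (norm_le_one_of_mem_unitary hu) (norm_nonneg _) norm_one_le_one

/-- Both `L_u` and its inverse `L_(u*)` are contractions. -/
theorem norm_L_apply_of_mem_unitary {u : M} (hu : u ∈ unitary M) (v : I.Compl) :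
    ‖I.L u v‖ = ‖v‖ := by
  refine (I.norm_L_apply_le_of_mem_unitary hu v).antisymm ?_
  have h := I.norm_L_apply_le_of_mem_unitary (Unitary.star_mem hu) (I.L u v)
  rwa [← mul_apply_eq_comp, ← L_mul, Unitary.star_mul_self_of_mem hu, L_one,
    one_apply_eq_self] at h

theorem norm_R_apply_of_mem_unitary {u : M} (hu : u ∈ unitary M) (v : I.Compl) :
    ‖I.R u v‖ = ‖v‖ := by
  refine (I.norm_R_apply_le_of_mem_unitary hu v).antisymm ?_
  have h := I.norm_R_apply_le_of_mem_unitary (Unitary.star_mem hu) (I.R u v)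
  rwa [← mul_apply_eq_comp, ← R_mul, Unitary.mul_star_self_of_mem hu, R_one,
    one_apply_eq_self] at h

/-- Left multiplication on the completed ideal, as a homomorphism of rings. -/
noncomputable def leftHom : M →+* (I.Compl →L[ℂ] I.Compl) where
  toFun := I.L
  map_one' := I.L_one
  map_mul' := I.L_mul
  map_zero' := by simpa using I.L_smul 0 0
  map_add' := I.L_add

/-- Right multiplication on the completed ideal, as a homomorphism from the opposite ring. -/
noncomputable def rightHom : Mᵐᵒᵖ →+* (I.Compl →L[ℂ] I.Compl) where
  toFun x := I.R x.unop
  map_one' := I.R_one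
  map_mul' x y := I.R_mul y.unop x.unop
  map_zero' := by simpa using I.R_smul 0 0
  map_add' x y := I.R_add x.unop y.unop

theorem continuous_leftHom : Continuous I.leftHom :=
  AddMonoidHomClass.continuous_of_bound I.leftHom ‖(1 : M)‖ fun x =>
    ContinuousLinearMap.opNorm_le_bound _ (by positivity) fun v => by
      rw [mul_comm ‖(1 : M)‖]; exact I.norm_L_apply_le x v

theorem continuous_rightHom : Continuous I.rightHom :=
  AddMonoidHomClass.continuous_of_bound I.rightHom ‖(1 : M)‖ fun x =>
    ContinuousLinearMap.opNorm_le_bound _ (by positivity) fun v => by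
      rw [mul_comm ‖(1 : M)‖]; exact I.norm_R_apply_le x.unop v

theorem L_exp (x : M) : I.L (NormedSpace.exp x) = NormedSpace.exp (I.L x) := by
  let +nondep : NormedAlgebra ℚ M := .restrictScalars ℚ ℂ M
  let +nondep : Algebra ℚ (I.Compl →L[ℂ] I.Compl) := .compHom _ (algebraMap ℚ ℂ)
  exact NormedSpace.map_exp I.leftHom I.continuous_leftHom x

theorem R_exp (x : M) : I.R (NormedSpace.exp x) = NormedSpace.exp (I.R x) := by
  let +nondep : NormedAlgebra ℚ Mᵐᵒᵖ := .restrictScalars ℚ ℂ Mᵐᵒᵖ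
  let +nondep : Algebra ℚ (I.Compl →L[ℂ] I.Compl) := .compHom _ (algebraMap ℚ ℂ)
  have h := NormedSpace.map_exp I.rightHom I.continuous_rightHom (MulOpposite.op x)
  rwa [NormedSpace.exp_op] at h

theorem exp_smul_L_sub_R (c : ℂ) (x y : M) :
    NormedSpace.exp (c • (I.L x - I.R y)) =
      I.L (NormedSpace.exp (c • x)) * I.R (NormedSpace.exp (-(c • y))) := by
  have e : c • (I.L x - I.R y) = I.L (c • x) + I.R (-(c • y)) := by
    rw [← neg_smul, L_smul, R_smul, smul_sub, neg_smul, sub_eq_add_neg]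
  rw [e, exp_add_of_commute_complex (I.L_R_commute _ _), L_exp, R_exp]

/-- `e^(itD)` is left multiplication by `e^(itX)` composed with right multiplication by `e^(-itY)`,
and both elements are unitary. -/
theorem isHermitianOperator_L_sub_R {x y : M} (hx : IsSelfAdjoint x) (hy : IsSelfAdjoint y) :
    IsHermitianOperator (I.L x - I.R y) := by
  have hu : ∀ {a : M} (_ : IsSelfAdjoint a) (t : ℝ),
      NormedSpace.exp ((t * Complex.I) • a) ∈ unitary M := by
    intro a ha t
    let +nondep : NormedAlgebra ℚ M := .restrictScalars ℚ ℂ M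
    refine NormedSpace.exp_mem_unitary_of_mem_skewAdjoint ?_
    rw [skewAdjoint.mem_iff, star_smul, ha.star_eq]
    simp
  intro t v
  rw [exp_smul_L_sub_R, mul_apply_eq_comp, ← neg_smul, ← neg_mul,
    ← Complex.ofReal_neg, I.norm_L_apply_of_mem_unitary (hu hx t),
    I.norm_R_apply_of_mem_unitary (hu hy _)]

end NormedIdeal

/-! ### Polar decomposition and the inequalities -/

/-- The polar decomposition of an invertible element `S` with `|S| = e^X`. -/
theorem exists_unitary_mul_exp {M : Type*} [CStarAlgebra M] [PartialOrder M] [StarOrderedRing M]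
    (S : Mˣ) {X : M} (hX : IsSelfAdjoint X) (hS : CFC.abs (S : M) = NormedSpace.exp X) :
    ∃ U ∈ unitary M, (S : M) = U * NormedSpace.exp X ∧
      ((S⁻¹ : Mˣ) : M) = NormedSpace.exp (-X) * star U ∧
      star (S : M) = NormedSpace.exp X * star U ∧
      (((star S)⁻¹ : Mˣ) : M) = U * NormedSpace.exp (-X) := by
  have hsq : star (S : M) * S = NormedSpace.exp X * NormedSpace.exp X := by
    rw [← hS, CFC.abs_mul_abs]
  have hstar : star (NormedSpace.exp (-X)) = NormedSpace.exp (-X) := hX.neg.exp.star_eq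
  have hstar' : star (NormedSpace.exp X) = NormedSpace.exp X := hX.exp.star_eq
  have e1 := exp_mul_exp_neg X
  have e2 := exp_neg_mul_exp X
  set e := NormedSpace.exp X
  set f := NormedSpace.exp (-X)
  have hSU : (S : M) = S * f * e := by rw [mul_assoc, e2, mul_one]
  -- The unitary is `U = S e^(-X)`: `U*U = e^(-X) S*S e^(-X) = 1` as `S*S = e^X e^X`. Invertibility
  -- of `S` then yields `UU* = 1`.
  have hl : star ((S : M) * f) * (S * f) = 1 := by
    rw [star_mul, hstar, show f * star (S : M) * (S * f) = f * (star (S : M) * S) * f by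
      simp only [mul_assoc], hsq, ← mul_assoc, e2, one_mul, e1]
  have hinv : ((S⁻¹ : Mˣ) : M) = f * star ((S : M) * f) := by
    rw [Units.inv_eq_of_mul_eq_one_left (u := S) (a := f * star ((S : M) * f))]
    rw [mul_assoc]
    nth_rewrite 2 [hSU]
    rw [← mul_assoc (star _), hl, one_mul, e2]
  have hr : (S : M) * f * star ((S : M) * f) = 1 := by
    rw [mul_assoc, ← hinv, Units.mul_inv]
  refine ⟨S * f, ⟨hl, hr⟩, hSU, hinv, ?_, ?_⟩
  · conv_lhs => rw [hSU]
    rw [star_mul, hstar']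
  · refine Units.inv_eq_of_mul_eq_one_right ?_
    rw [Units.coe_star, ← mul_assoc, ← mul_assoc, hsq, mul_assoc e e f, e1, mul_one, e1]

theorem mainTheorem10 {M : Type*} [CStarAlgebra M] [PartialOrder M] [StarOrderedRing M]
    (I : NormedIdeal M) (S R : Mˣ) (X Y : M) (hX : IsSelfAdjoint X) (hY : IsSelfAdjoint Y)
    (hS : CFC.abs (S : M) = NormedSpace.exp X) (hR : CFC.abs (R : M) = NormedSpace.exp Y) :
    IsUnit (banachCosh (I.L X - I.R Y)) ∧
    ∀ T : I.Compl,
      ‖I.L (S : M) (I.R ((R⁻¹ : Mˣ) : M) T)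
          - I.L (((star S)⁻¹ : Mˣ) : M) (I.R (star (R : M)) T)‖
        ≤ ‖banachTanh (I.L X - I.R Y)‖ *
          ‖I.L (S : M) (I.R ((R⁻¹ : Mˣ) : M) T)
            + I.L (((star S)⁻¹ : Mˣ) : M) (I.R (star (R : M)) T)‖ ∧
      ‖I.L (S : M) (I.R ((R⁻¹ : Mˣ) : M) T)
          - I.L (((star S)⁻¹ : Mˣ) : M) (I.R (star (R : M)) T)‖
        ≤ ‖I.L X - I.R Y‖ *
          ‖I.L (S : M) (I.R ((R⁻¹ : Mˣ) : M) T)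
            + I.L (((star S)⁻¹ : Mˣ) : M) (I.R (star (R : M)) T)‖ := by
  obtain ⟨U, hU, hS1, -, -, hS2⟩ := exists_unitary_mul_exp S hX hS
  obtain ⟨V, hV, -, hR1, hR2, -⟩ := exists_unitary_mul_exp R hY hR
  have hD := I.isHermitianOperator_L_sub_R hX hY
  have hp : NormedSpace.exp (I.L X - I.R Y) =
      I.L (NormedSpace.exp X) * I.R (NormedSpace.exp (-Y)) := by
    simpa using I.exp_smul_L_sub_R 1 X Y
  have hm : NormedSpace.exp (-(I.L X - I.R Y)) =
      I.L (NormedSpace.exp (-X)) * I.R (NormedSpace.exp Y) := by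
    simpa using I.exp_smul_L_sub_R (-1) X Y
  have hVs := Unitary.star_mem hV
  -- `R` reverses products and commutes with `L`, so both unitaries can be pulled out on the left.
  have factor : ∀ a b : M, I.L (U * a) * I.R (b * star V) =
      I.L U * I.R (star V) * (I.L a * I.R b) := by
    intro a b
    rw [I.L_mul, I.R_mul, mul_assoc, ← mul_assoc (I.L a), (I.L_R_commute a (star V)).eq]
    simp only [mul_assoc]
  set D := I.L X - I.R Y
  have hiso : ∀ v, ‖(I.L U * I.R (star V)) v‖ = ‖v‖ := fun v => by
    rw [mul_apply_eq_comp, I.norm_L_apply_of_mem_unitary hU,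
      I.norm_R_apply_of_mem_unitary hVs]
  have h1 : ∀ T, I.L (S : M) (I.R ((R⁻¹ : Mˣ) : M) T) =
      (I.L U * I.R (star V)) (NormedSpace.exp D T) := fun T => by
    rw [← mul_apply_eq_comp, hS1, hR1, factor, ← hp, mul_apply_eq_comp]
  have h2 : ∀ T, I.L (((star S)⁻¹ : Mˣ) : M) (I.R (star (R : M)) T) =
      (I.L U * I.R (star V)) (NormedSpace.exp (-D) T) := fun T => by
    rw [← mul_apply_eq_comp, hS2, hR2, factor, ← hm, mul_apply_eq_comp]
  have hsinh : ∀ T, ‖NormedSpace.exp D T - NormedSpace.exp (-D) T‖ = 2 * ‖banachSinh D T‖ := by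
    intro T
    rw [banachSinh, smul_apply, sub_apply, norm_smul]
    norm_num
    ring
  have hcosh : ∀ T, ‖NormedSpace.exp D T + NormedSpace.exp (-D) T‖ = 2 * ‖banachCosh D T‖ := by
    intro T
    rw [banachCosh, smul_apply, add_apply, norm_smul]
    norm_num
    ring
  refine ⟨hD.isUnit_banachCosh, fun T => ?_⟩
  rw [h1, h2, ← map_sub, ← map_add, hiso, hiso, hsinh, hcosh]
  constructor
  · have h3 : banachSinh D T = banachTanh D (banachCosh D T) := by
      rw [← mul_apply_eq_comp, banachTanh, mul_assoc,
        Ring.inverse_mul_cancel _ hD.isUnit_banachCosh, mul_one]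
    have := (banachTanh D).le_opNorm (banachCosh D T)
    rw [h3]
    linarith
  · have := hD.norm_banachSinh_le T
    linarith
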